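/- Let $\lambda$ be a $\sigma$-finite Borel measure on a set $\mathcal X\subset\mathbb R^d$ with $\lambda(\mathcal X)\neq 0$, let $s:\mathcal X\to\mathbb R^k$ be Borel measurable, and put $$\kappa(\theta)=\log\int_{\mathcal X}\exp(\theta^{\mathsf T}s(x))\,d\lambda(x),\qquad p_\theta(x)=\exp\big(\theta^{\mathsf T}s(x)-\kappa(\theta)\big),\qquad P_\theta(E)=\int_E p_\theta\,d\lambda .$$ Let $\Theta=\{\theta\in\mathbb R^k:\kappa(\theta)<\infty\}$, and suppose that $\Theta$ is nonempty and open, and that $P_\theta\neq P_{\theta'}$ whenever $\theta\neq\theta'$ in $\Theta$. Let $\mathcal M=\{\int s\,dP_\theta:\theta\in\Theta\}$, let $\xi\in\mathbb R^k$ and $\nu>0$ be such that $\xi/\nu\in\mathcal M$, and let $$\pi_{\xi,\nu}(\theta)=\exp\big(\xi^{\mathsf T}\theta-\nu\kappa(\theta)-\psi(\xi,\nu)\big)\,I(\theta\in\Theta),\qquad \psi(\xi,\nu)=\log\int_\Theta\exp\big(\xi^{\mathsf T}\theta-\nu\kappa(\theta)\big)\,d\theta .$$ For $x_1,\dots,x_n\in\mathcal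 X$ define $$m(x_{1:n})=\int_\Theta\Big(\prod_{j=1}^n p_\theta(x_j)\Big)\pi_{\xi,\nu}(\theta)\,d\theta,\qquad \mu_{x_{1:n}}=\frac{\xi+\sum_{j=1}^n s(x_j)}{\nu+n},$$ $$G(\mu)=\sup_{\theta\in\Theta}\big(\theta^{\mathsf T}\mu-\kappa(\theta)\big),\qquad \tilde m(x_{1:n})=(\nu+n)^{-k/2}\exp\big((\nu+n)\,G(\mu_{x_{1:n}})\big).$$ Then for every compact set $U\subset\mathcal M$ there exist constants $0<C_1\le C_2<\infty$ such that for every $n\ge 1$ and all $x_1,\dots,x_n\in\mathcal X$ with $\mu_{x_{1:n}}\in U$, $$C_1\le\frac{m(x_{1:n})}{\tilde m(x_{1:n})}\le C_2 .$$ -/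

import Mathlib

open MeasureTheory

noncomputable section

/-- An exponential family in canonical form, with sample space `X ⊆ ℝᵈ`, base measure `lam` on `X`,
sufficient statistics `s : X → ℝᵏ` and parameter set `Θ ⊆ ℝᵏ`. -/
structure ExpFamily (d k : ℕ) where
  /-- the sample space, with the Borel sigma-algebra of a subspace of `ℝᵈ` -/
  X : Set (EuclideanSpace ℝ (Fin d))
  /-- the base measure -/
  lam : Measure X
  sigmaFinite_lam : SigmaFinite lam
  lam_ne_zero : lam ≠ 0
  /-- the sufficient statistics -/
  s : X → EuclideanSpace ℝ (Fin k)
  measurable_s : Measurable s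
  /-- the parameter set -/
  Θ : Set (EuclideanSpace ℝ (Fin k))

namespace ExpFamily

variable {d k : ℕ} (F : ExpFamily d k)

/-- The log-partition function `κ(θ) = log ∫ exp(θᵀ s(x)) dλ(x)`, as an extended real (the integral
may be infinite). -/
def kappa (θ : EuclideanSpace ℝ (Fin k)) : EReal :=
  ENNReal.log (∫⁻ x, ENNReal.ofReal (Real.exp (inner ℝ θ (F.s x))) ∂F.lam)

/-- The density `p_θ(x) = exp(θᵀ s(x) - κ(θ))`. -/
def density (θ : EuclideanSpace ℝ (Fin k)) (x : F.X) : ENNReal :=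
  EReal.exp ((inner ℝ θ (F.s x) : ℝ) - F.kappa θ)

/-- The measure `P_θ(E) = ∫_E p_θ dλ`. -/
def P (θ : EuclideanSpace ℝ (Fin k)) : Measure F.X :=
  F.lam.withDensity (F.density θ)

/-- The regularity conditions: the family is full, nonempty, regular and identifiable. -/
structure Regularity : Prop where
  full : F.Θ = {θ | F.kappa θ < ⊤}
  nonempty : F.Θ.Nonempty
  regular : IsOpen F.Θ
  identifiable : ∀ θ ∈ F.Θ, ∀ θ' ∈ F.Θ, θ ≠ θ' → F.P θ ≠ F.P θ'

/-- The moment space `M = {E_θ s(X) : θ ∈ Θ}`. (Under the regularity conditions, `s` is integrable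
under `P_θ` for each `θ ∈ Θ`.) -/
def momentSpace : Set (EuclideanSpace ℝ (Fin k)) :=
  {μ | ∃ θ ∈ F.Θ, μ = ∫ x, F.s x ∂F.P θ}

/-- The set `Ξ` of conjugate hyperparameters `(ξ, ν)`, where `ν > 0` and `ξ / ν ∈ M`. -/
def hyperparams : Set (EuclideanSpace ℝ (Fin k) × ℝ) :=
  {p | 0 < p.2 ∧ p.2⁻¹ • p.1 ∈ F.momentSpace}

/-- `ψ(ξ, ν) = log ∫_Θ exp(ξᵀθ - ν κ(θ)) dθ`, as an extended real. -/
def psi (ξ : EuclideanSpace ℝ (Fin k)) (ν : ℝ) : EReal :=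
  ENNReal.log (∫⁻ θ in F.Θ, EReal.exp ((inner ℝ ξ θ : ℝ) - (ν : EReal) * F.kappa θ))

/-- The conjugate prior density `π_{ξ,ν}(θ) = exp(ξᵀθ - ν κ(θ) - ψ(ξ, ν)) I(θ ∈ Θ)` with respect to
Lebesgue measure on `ℝᵏ`. -/
def prior (ξ : EuclideanSpace ℝ (Fin k)) (ν : ℝ) : EuclideanSpace ℝ (Fin k) → ENNReal :=
  F.Θ.indicator fun θ =>
    EReal.exp ((inner ℝ ξ θ : ℝ) - (ν : EReal) * F.kappa θ - F.psi ξ ν)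

/-- An exponential family with conjugate prior `π_{ξ,ν}` is well-behaved. -/
structure WellBehaved (ξ : EuclideanSpace ℝ (Fin k)) (ν : ℝ) : Prop where
  regularity : F.Regularity
  mem_hyperparams : (ξ, ν) ∈ F.hyperparams

/-- The marginal density `m(x_{1:n}) = ∫_Θ (∏ⱼ p_θ(xⱼ)) π_{ξ,ν}(θ) dθ`. -/
def marginal (ξ : EuclideanSpace ℝ (Fin k)) (ν : ℝ) {n : ℕ} (x : Fin n → F.X) : ENNReal :=
  ∫⁻ θ in F.Θ, (∏ j, F.density θ (x j)) * F.prior ξ ν θ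

/-- The Legendre transform `G(μ) = sup_{θ ∈ Θ} (θᵀμ - κ(θ))`. -/
def legendre (μ : EuclideanSpace ℝ (Fin k)) : EReal :=
  ⨆ θ ∈ F.Θ, ((inner ℝ θ μ : ℝ) : EReal) - F.kappa θ

/-- `μ_{x_{1:n}} = (ξ + ∑ⱼ s(xⱼ)) / (ν + n)`. -/
def posteriorMean (ξ : EuclideanSpace ℝ (Fin k)) (ν : ℝ) {n : ℕ} (x : Fin n → F.X) :
    EuclideanSpace ℝ (Fin k) :=
  (ν + n)⁻¹ • (ξ + ∑ j, F.s (x j))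

/-- The approximation `m̃(x_{1:n}) = (ν + n)^{-k/2} exp((ν + n) G(μ_{x_{1:n}}))`. -/
def approxMarginal (ξ : EuclideanSpace ℝ (Fin k)) (ν : ℝ) {n : ℕ} (x : Fin n → F.X) : ENNReal :=
  ENNReal.ofReal ((ν + n) ^ (-(k : ℝ) / 2)) *
    EReal.exp (((ν + n : ℝ) : EReal) * F.legendre (F.posteriorMean ξ ν x))

end ExpFamily

end

/-! Write `N = ν + n` and choose `θ₁` whose mean is `μ_x`. Then `⟨Nμ_x, θ⟩ - Nκ(θ) = N G(μ_x) - N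
B(θ, θ₁)`, where `B` is the Bregman divergence of `κ`. So the ratio of marginal to approximation is
exactly `exp(-ψ)` times the normalised Laplace integral `N^{k/2} ∫ exp(-N B(θ, θ₁)) dθ`
(`marginal_div_approxMarginal_eq`). It remains to bound this integral away from `0` and `∞`,
uniformly in `N ≥ ν` and in `θ₁` with mean in `U`.

Uniformity comes from `exists_local_bregman_bounds`: near a fixed parameter, `B` lies between two
quadratics with common constants, and by convexity its lower bound grows linearly further out. These
bounds need no derivatives of `κ`: elementary inequalities for `exp` are integrated against the
centred family. Strict positivity of the lower constant uses identifiability and compactness.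

Compactness of `U` is used in mean space. No inverse of the mean map is needed: the symmetrised
divergence equals `⟨mean θ₁ - mean θ₀, θ₁ - θ₀⟩`, so linear growth forces parameters with close
means to be close. -/

noncomputable section

namespace ExpFamily

/-! ### Scalar inequalities for the exponential -/

section Exp

/-- The damping factor is needed as `t → -∞`, where `exp t - 1 - t` grows only linearly. -/
lemma one_add_add_sq_mul_exp_le_exp (t : ℝ) :
    1 + t + t ^ 2 / 4 * Real.exp (-|t|) ≤ Real.exp t := by
  have h1 : Real.exp (-|t|) ≤ 1 := Real.exp_le_one_iff.2 (by simp)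
  rcases le_or_gt 0 t with ht | ht
  · nlinarith [Real.quadratic_le_exp_of_nonneg ht, sq_nonneg t]
  · rw [abs_of_neg ht] at *
    rw [neg_neg] at *
    rcases le_or_gt (-2) t with h2 | h2
    · have h3 : 1 + t / 2 ≤ Real.exp (t / 2) := by linarith [Real.add_one_le_exp (t / 2)]
      have h4 : Real.exp t = Real.exp (t / 2) ^ 2 := by
        rw [← Real.exp_nat_mul]; ring_nf
      have h5 : (1 + t / 2) ^ 2 ≤ Real.exp t := by
        rw [h4]; exact pow_le_pow_left₀ (by linarith) h3 2
      nlinarith [sq_nonneg t]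
    · have h3 := Real.quadratic_le_exp_of_nonneg (x := -t) (by linarith)
      have h4 : t ^ 2 / 2 * Real.exp t ≤ 1 := by
        have : t ^ 2 / 2 ≤ Real.exp (-t) := by nlinarith
        calc _ ≤ Real.exp (-t) * Real.exp t := by gcongr
          _ = 1 := by rw [← Real.exp_add]; simp
      linarith [Real.exp_pos t]

lemma exp_le_one_add_add_sq_mul_exp (t : ℝ) :
    Real.exp t ≤ 1 + t + t ^ 2 * Real.exp |t| := by
  have h0 : 1 ≤ Real.exp |t| := Real.one_le_exp (abs_nonneg t)
  rcases le_or_gt |t| 1 with h | h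
  · have := abs_le.1 (Real.abs_exp_sub_one_sub_id_le h)
    nlinarith [sq_nonneg t]
  · rcases lt_abs.1 h with h | h
    · rw [abs_of_pos (by linarith)]
      nlinarith [mul_nonneg (by nlinarith : 0 ≤ t ^ 2 - 1) (Real.exp_pos t).le]
    · have h1 : Real.exp t ≤ 1 := Real.exp_le_one_iff.2 (by linarith)
      nlinarith [sq_nonneg t]

lemma le_exp_div {r t : ℝ} (hr : 0 < r) : t ≤ Real.exp (r * t) / r := by
  rw [le_div_iff₀ hr]; linarith [Real.add_one_le_exp (r * t)]

lemma sq_le_exp_div {r t : ℝ} (hr : 0 < r) (ht : 0 ≤ t) :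
    t ^ 2 ≤ 2 / r ^ 2 * Real.exp (r * t) := by
  have := Real.quadratic_le_exp_of_nonneg (x := r * t) (by positivity)
  rw [div_mul_eq_mul_div, le_div_iff₀ (by positivity)]
  nlinarith [mul_nonneg hr.le ht]

end Exp

/-! ### Partition function, mean and Bregman divergence of an exponential family -/

variable {Ω : Type*} [MeasurableSpace Ω] {k : ℕ}

/-- The partition function of the exponential family with statistic `s` and base measure `lam`. -/
def partition (lam : Measure Ω) (s : Ω → EuclideanSpace ℝ (Fin k))
    (θ : EuclideanSpace ℝ (Fin k)) : ℝ :=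
  ∫ x, Real.exp (inner ℝ θ (s x)) ∂lam

/-- The real-valued log-partition function. -/
def cumulant (lam : Measure Ω) (s : Ω → EuclideanSpace ℝ (Fin k))
    (θ : EuclideanSpace ℝ (Fin k)) : ℝ :=
  Real.log (partition lam s θ)

/-- The mean of the sufficient statistic at parameter `θ`. -/
def mean (lam : Measure Ω) (s : Ω → EuclideanSpace ℝ (Fin k))
    (θ : EuclideanSpace ℝ (Fin k)) : EuclideanSpace ℝ (Fin k) :=
  (partition lam s θ)⁻¹ • ∫ x, Real.exp (inner ℝ θ (s x)) • s x ∂lam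

/-- The set of parameters at which the partition function is finite. -/
def domain (lam : Measure Ω) (s : Ω → EuclideanSpace ℝ (Fin k)) :
    Set (EuclideanSpace ℝ (Fin k)) :=
  {θ | Integrable (fun x => Real.exp (inner ℝ θ (s x))) lam}

/-- The Bregman divergence of the log-partition function. -/
def bregman (lam : Measure Ω) (s : Ω → EuclideanSpace ℝ (Fin k))
    (θ θ₁ : EuclideanSpace ℝ (Fin k)) : ℝ :=
  cumulant lam s θ - cumulant lam s θ₁ - inner ℝ (mean lam s θ₁) (θ - θ₁)

variable {lam : Measure Ω} {s : Ω → EuclideanSpace ℝ (Fin k)}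

lemma partition_pos (hl : lam ≠ 0) {θ : EuclideanSpace ℝ (Fin k)}
    (hθ : θ ∈ domain lam s) : 0 < partition lam s θ := by
  have : NeZero lam := ⟨hl⟩
  exact integral_exp_pos hθ

/-- The norm is at most `k` times the largest coordinate in absolute value, so one of the `2k`
exponentials dominates; the summand `1` serves `k = 0`. -/
lemma exp_mul_norm_le_sum (v : EuclideanSpace ℝ (Fin k)) {ρ : ℝ} (hρ : 0 ≤ ρ) :
    Real.exp (ρ * ‖v‖) ≤ 1 + ∑ i, (Real.exp (inner ℝ ((ρ * k) • EuclideanSpace.single i (1:ℝ)) v) +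
      Real.exp (inner ℝ (-((ρ * k) • EuclideanSpace.single i (1:ℝ))) v)) := by
  have hin : ∀ i, inner ℝ ((ρ * k) • EuclideanSpace.single i (1:ℝ)) v = ρ * k * v i := by
    intro i
    rw [real_inner_smul_left, EuclideanSpace.inner_single_left]; simp
  simp only [inner_neg_left, hin]
  have hnn : ∀ i ∈ Finset.univ, 0 ≤ Real.exp (ρ * k * v i) + Real.exp (-(ρ * k * v i)) :=
    fun i _ => by positivity
  rcases isEmpty_or_nonempty (Fin k) with h | h
  · have : v = 0 := Subsingleton.elim _ _
    simp [this]
  · obtain ⟨i, -, hi⟩ := Finset.exists_max_image Finset.univ (fun i => |v i|) Finset.univ_nonempty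
    have hn : ‖v‖ ≤ k * |v i| := by
      calc ‖v‖ = ‖∑ i, v i • EuclideanSpace.single i (1:ℝ)‖ := by
            congr 1; ext j; simp [Finset.sum_apply, Pi.single_apply]
        _ ≤ ∑ j, |v j| := (norm_sum_le _ _).trans (by simp [norm_smul])
        _ ≤ ∑ j : Fin k, |v i| := Finset.sum_le_sum fun j hj => hi j hj
        _ = k * |v i| := by simp
    calc Real.exp (ρ * ‖v‖) ≤ Real.exp |ρ * k * v i| := by
          apply Real.exp_le_exp.2
          rw [abs_mul, abs_of_nonneg (by positivity : 0 ≤ ρ * k), mul_assoc]; gcongr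
      _ ≤ Real.exp (ρ * k * v i) + Real.exp (-(ρ * k * v i)) := by
          rcases abs_choice (ρ * k * v i) with h | h <;> rw [h] <;>
            linarith [Real.exp_pos (ρ * k * v i), Real.exp_pos (-(ρ * k * v i))]
      _ ≤ ∑ i, (Real.exp (ρ * k * v i) + Real.exp (-(ρ * k * v i))) :=
          Finset.single_le_sum hnn (Finset.mem_univ i)
      _ ≤ _ := by linarith

/-- Openness leaves room to shift `θ` along every coordinate axis. The resulting dominating function
has enough spare exponential growth to absorb moving the parameter by `r`, polynomial factors in
`s`, and a further tilt by `r`. -/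
lemma exists_integrable_exp_inner_add_norm (hs : Measurable s) (ho : IsOpen (domain lam s))
    {θ : EuclideanSpace ℝ (Fin k)} (hθ : θ ∈ domain lam s) :
    ∃ r > 0, Integrable (fun x => Real.exp (inner ℝ θ (s x) + 4 * r * ‖s x‖)) lam := by
  obtain ⟨ε, hε, hb⟩ := Metric.isOpen_iff.1 ho θ hθ
  -- The shifts have length `4rk = εk / (2(k+1)) < ε`.
  set r : ℝ := ε / (8 * (k + 1)) with hr
  have hr0 : 0 < r := by positivity
  refine ⟨r, hr0, ?_⟩
  have hmem : ∀ i, ‖(4 * r * k) • (EuclideanSpace.single i (1:ℝ) : EuclideanSpace ℝ (Fin k))‖ < ε := by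
    intro i
    rw [norm_smul, Real.norm_of_nonneg (by positivity)]
    simp only [PiLp.norm_single, norm_one, mul_one]
    rw [hr, ← mul_div_assoc, div_mul_eq_mul_div, div_lt_iff₀ (by positivity)]
    nlinarith [Nat.cast_nonneg (α := ℝ) k]
  have hint : ∀ i, Integrable (fun x => Real.exp (inner ℝ θ (s x)) *
      (Real.exp (inner ℝ ((4 * r * k) • EuclideanSpace.single i (1:ℝ)) (s x)) +
      Real.exp (inner ℝ (-((4 * r * k) • EuclideanSpace.single i (1:ℝ))) (s x)))) lam := by
    intro i
    simp only [mul_add, ← Real.exp_add, ← inner_add_left]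
    refine Integrable.add (hb ?_) (hb ?_)
    · simpa using hmem i
    · simpa [-norm_neg, dist_eq_norm, norm_neg] using hmem i
  have hθ' : Integrable (fun x => Real.exp (inner ℝ θ (s x))) lam := hθ
  refine (hθ'.add (integrable_finsetSum Finset.univ fun i _ => hint i)).mono' ?_ ?_
  · fun_prop
  · refine Filter.Eventually.of_forall fun x => ?_
    rw [Real.norm_of_nonneg (Real.exp_pos _).le, Real.exp_add]
    simp only [Pi.add_apply]
    rw [← Finset.mul_sum]
    calc _ ≤ Real.exp (inner ℝ θ (s x)) * _ :=
          mul_le_mul_of_nonneg_left (exp_mul_norm_le_sum (s x) (by positivity : 0 ≤ 4 * r)) (by positivity)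
      _ = _ := by rw [mul_add, mul_one]


/-! ### Uniform local bounds on the Bregman divergence -/

section LocalBounds

variable {Ω : Type*} [MeasurableSpace Ω] {k : ℕ} {lam : Measure Ω}
  {s : Ω → EuclideanSpace ℝ (Fin k)} {θ₀ θ₁ θ : EuclideanSpace ℝ (Fin k)} {r : ℝ}

lemma inner_le_inner_add_of_norm_sub_le {a : ℝ} (h : ‖θ₁ - θ₀‖ ≤ a)
    (v : EuclideanSpace ℝ (Fin k)) : inner ℝ θ₁ v ≤ inner ℝ θ₀ v + a * ‖v‖ := by
  have h1 : inner ℝ (θ₁ - θ₀) v ≤ a * ‖v‖ :=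
    (real_inner_le_norm _ _).trans (by gcongr)
  rw [inner_sub_left] at h1
  linarith

lemma mem_domain_of_norm_sub_le (hs : Measurable s)
    (hI : Integrable (fun x => Real.exp (inner ℝ θ₀ (s x) + 4 * r * ‖s x‖)) lam)
    (h : ‖θ₁ - θ₀‖ ≤ 4 * r) : θ₁ ∈ domain lam s := by
  refine hI.mono' (by fun_prop) (Filter.Eventually.of_forall fun x => ?_)
  rw [Real.norm_of_nonneg (Real.exp_pos _).le]
  exact Real.exp_le_exp.2 (inner_le_inner_add_of_norm_sub_le h _)

lemma norm_exp_smul_le (hr : 0 < r) (h : ‖θ₁ - θ₀‖ ≤ r) (v : EuclideanSpace ℝ (Fin k)) :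
    ‖Real.exp (inner ℝ θ₁ v) • v‖ ≤ r⁻¹ * Real.exp (inner ℝ θ₀ v + 4 * r * ‖v‖) := by
  rw [norm_smul, Real.norm_of_nonneg (Real.exp_pos _).le]
  calc _ ≤ Real.exp (inner ℝ θ₀ v + r * ‖v‖) * (Real.exp (r * ‖v‖) / r) := by
        gcongr
        · exact inner_le_inner_add_of_norm_sub_le h _
        · exact le_exp_div hr
    _ = r⁻¹ * Real.exp (inner ℝ θ₀ v + 2 * r * ‖v‖) := by
        rw [← mul_div_assoc, ← Real.exp_add, div_eq_inv_mul]; ring_nf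
    _ ≤ _ := by gcongr; norm_num

lemma integrable_exp_smul (hs : Measurable s) (hr : 0 < r)
    (hI : Integrable (fun x => Real.exp (inner ℝ θ₀ (s x) + 4 * r * ‖s x‖)) lam)
    (h : ‖θ₁ - θ₀‖ ≤ r) : Integrable (fun x => Real.exp (inner ℝ θ₁ (s x)) • s x) lam :=
  (hI.const_mul r⁻¹).mono' (by fun_prop)
    (Filter.Eventually.of_forall fun x => norm_exp_smul_le hr h (s x))

lemma exists_partition_bounds (hs : Measurable s) (hl : lam ≠ 0) (hr : 0 < r)
    (hI : Integrable (fun x => Real.exp (inner ℝ θ₀ (s x) + 4 * r * ‖s x‖)) lam) :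
    ∃ z₀ z₁ : ℝ, 0 < z₀ ∧ ∀ θ₁, ‖θ₁ - θ₀‖ ≤ r →
      z₀ ≤ partition lam s θ₁ ∧ partition lam s θ₁ ≤ z₁ := by
  have : NeZero lam := ⟨hl⟩
  have hJ : Integrable (fun x => Real.exp (inner ℝ θ₀ (s x) - r * ‖s x‖)) lam := by
    refine hI.mono' (by fun_prop) (Filter.Eventually.of_forall fun x => ?_)
    rw [Real.norm_of_nonneg (Real.exp_pos _).le]
    exact Real.exp_le_exp.2 (by nlinarith [norm_nonneg (s x)])
  refine ⟨_, _, integral_exp_pos hJ, fun θ₁ h => ⟨integral_mono hJ ?_ fun x => ?_,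
    integral_mono ?_ hI fun x => ?_⟩⟩
  · exact mem_domain_of_norm_sub_le hs hI (by linarith)
  · apply Real.exp_le_exp.2
    have := inner_le_inner_add_of_norm_sub_le (norm_sub_rev θ₁ θ₀ ▸ h) (s x)
    linarith
  · exact mem_domain_of_norm_sub_le hs hI (by linarith)
  · exact Real.exp_le_exp.2 (inner_le_inner_add_of_norm_sub_le (by linarith) (s x))

lemma exists_norm_mean_le (hs : Measurable s) (hl : lam ≠ 0) (hr : 0 < r)
    (hI : Integrable (fun x => Real.exp (inner ℝ θ₀ (s x) + 4 * r * ‖s x‖)) lam) :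
    ∃ R : ℝ, ∀ θ₁, ‖θ₁ - θ₀‖ ≤ r → ‖mean lam s θ₁‖ ≤ R := by
  obtain ⟨z₀, z₁, hz, hb⟩ := exists_partition_bounds hs hl hr hI
  refine ⟨z₀⁻¹ * ∫ x, r⁻¹ * Real.exp (inner ℝ θ₀ (s x) + 4 * r * ‖s x‖) ∂lam, fun θ₁ h => ?_⟩
  have hZ := hb θ₁ h
  rw [mean, norm_smul, norm_inv, Real.norm_of_nonneg (hz.le.trans hZ.1)]
  gcongr
  · exact hZ.1
  · exact norm_integral_le_of_norm_le (hI.const_mul _)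
      (Filter.Eventually.of_forall fun x => norm_exp_smul_le hr h (s x))

/-- Centring at the mean removes the linear term when Taylor-type inequalities are integrated. -/
lemma integral_exp_mul_inner_sub_mean (hl : lam ≠ 0) (hθ : θ₁ ∈ domain lam s)
    (hi : Integrable (fun x => Real.exp (inner ℝ θ₁ (s x)) • s x) lam)
    (u : EuclideanSpace ℝ (Fin k)) :
    Integrable (fun x => Real.exp (inner ℝ θ₁ (s x)) * inner ℝ u (s x - mean lam s θ₁)) lam ∧
    ∫ x, Real.exp (inner ℝ θ₁ (s x)) * inner ℝ u (s x - mean lam s θ₁) ∂lam = 0 := by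
  have hθ' : Integrable (fun x => Real.exp (inner ℝ θ₁ (s x))) lam := hθ
  have heq : ∀ x, Real.exp (inner ℝ θ₁ (s x)) * inner ℝ u (s x - mean lam s θ₁) =
      inner ℝ u (Real.exp (inner ℝ θ₁ (s x)) • s x) -
        Real.exp (inner ℝ θ₁ (s x)) * inner ℝ u (mean lam s θ₁) := by
    intro x
    rw [inner_sub_right, real_inner_smul_right]; ring
  simp only [heq]
  have h1 := hi.const_inner (𝕜 := ℝ) u
  have h2 := hθ'.mul_const (inner ℝ u (mean lam s θ₁))
  refine ⟨h1.sub h2, ?_⟩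
  rw [integral_sub h1 h2, integral_inner hi, integral_mul_const, mean, real_inner_smul_right]
  change _ - partition lam s θ₁ * _ = 0
  rw [mul_inv_cancel_left₀ (partition_pos hl hθ).ne', sub_self]

/-- The centred moment generating function under `θ₁` is `exp` of the Bregman divergence, so
pointwise bounds on `exp` become bounds on `bregman`. -/
lemma integral_exp_mul_exp_inner_sub_mean (hl : lam ≠ 0) (hθ₁ : θ₁ ∈ domain lam s)
    (hθ : θ ∈ domain lam s) :
    Integrable (fun x => Real.exp (inner ℝ θ₁ (s x)) *
      Real.exp (inner ℝ (θ - θ₁) (s x - mean lam s θ₁))) lam ∧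
    ∫ x, Real.exp (inner ℝ θ₁ (s x)) * Real.exp (inner ℝ (θ - θ₁) (s x - mean lam s θ₁)) ∂lam =
      partition lam s θ₁ * Real.exp (bregman lam s θ θ₁) := by
  have hθ' : Integrable (fun x => Real.exp (inner ℝ θ (s x))) lam := hθ
  have heq : ∀ x, Real.exp (inner ℝ θ₁ (s x)) *
      Real.exp (inner ℝ (θ - θ₁) (s x - mean lam s θ₁)) =
      Real.exp (inner ℝ θ (s x)) * Real.exp (-inner ℝ (mean lam s θ₁) (θ - θ₁)) := by
    intro x
    rw [← Real.exp_add, ← Real.exp_add, inner_sub_right,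
      real_inner_comm (mean lam s θ₁) (θ - θ₁), inner_sub_left]
    ring_nf
  simp only [heq]
  refine ⟨hθ'.mul_const _, ?_⟩
  rw [integral_mul_const, bregman, sub_eq_add_neg (_ - _) (inner ℝ _ _), Real.exp_add, Real.exp_sub,
    cumulant, cumulant, Real.exp_log (partition_pos hl hθ), Real.exp_log (partition_pos hl hθ₁)]
  have := (partition_pos hl hθ₁).ne'
  rw [← partition]
  field_simp

lemma bregman_nonneg (hs : Measurable s) (hl : lam ≠ 0) (ho : IsOpen (domain lam s))
    (hθ₁ : θ₁ ∈ domain lam s) (hθ : θ ∈ domain lam s) : 0 ≤ bregman lam s θ θ₁ := by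
  obtain ⟨r, hr, hI⟩ := exists_integrable_exp_inner_add_norm hs ho hθ₁
  have hi := integrable_exp_smul hs hr hI (θ₁ := θ₁) (by simpa using hr.le)
  obtain ⟨h1, h2⟩ := integral_exp_mul_inner_sub_mean hl hθ₁ hi (θ - θ₁)
  obtain ⟨h3, h4⟩ := integral_exp_mul_exp_inner_sub_mean hl hθ₁ hθ
  have hθ' : Integrable (fun x => Real.exp (inner ℝ θ₁ (s x))) lam := hθ₁
  have h5 := integral_mono (hθ'.add h1) h3 fun x => by
    simp only [Pi.add_apply]
    nlinarith [Real.exp_pos (inner ℝ θ₁ (s x)),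
      Real.add_one_le_exp (inner ℝ (θ - θ₁) (s x - mean lam s θ₁))]
  rw [integral_add' hθ' h1, h2, h4, add_zero] at h5
  have h6 := partition_pos hl hθ₁
  rw [← partition] at h5
  exact Real.one_le_exp_iff.1 (by nlinarith)

/-- The weighted second moment of the statistic in direction `w` around the centre `m`. -/
def dampedMoment (lam : Measure Ω) (s : Ω → EuclideanSpace ℝ (Fin k)) (r : ℝ)
    (p : EuclideanSpace ℝ (Fin k) × EuclideanSpace ℝ (Fin k) × EuclideanSpace ℝ (Fin k)) : ℝ :=
  ∫ x, Real.exp (inner ℝ p.2.1 (s x)) *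
    ((inner ℝ p.1 (s x - p.2.2)) ^ 2 / 4 * Real.exp (-(r * ‖s x - p.2.2‖))) ∂lam

lemma norm_dampedMoment_integrand_le (hr : 0 < r) {w m : EuclideanSpace ℝ (Fin k)}
    (hw : ‖w‖ ≤ 1) (h : ‖θ₁ - θ₀‖ ≤ r) (v : EuclideanSpace ℝ (Fin k)) :
    ‖Real.exp (inner ℝ θ₁ v) * ((inner ℝ w (v - m)) ^ 2 / 4 * Real.exp (-(r * ‖v - m‖)))‖ ≤
      r⁻¹ ^ 2 * Real.exp (inner ℝ θ₀ v + 4 * r * ‖v‖) := by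
  rw [Real.norm_of_nonneg (by positivity), mul_comm]
  have h1 : (inner ℝ w (v - m)) ^ 2 / 4 * Real.exp (-(r * ‖v - m‖)) ≤ r⁻¹ ^ 2 := by
    have h2 : |inner ℝ w (v - m)| ≤ ‖v - m‖ :=
      (abs_real_inner_le_norm _ _).trans (mul_le_of_le_one_left (norm_nonneg _) hw)
    have h3 : (inner ℝ w (v - m)) ^ 2 ≤ ‖v - m‖ ^ 2 := sq_le_sq' (by linarith [abs_le.1 h2]) (abs_le.1 h2).2
    have h4 := sq_le_exp_div hr (norm_nonneg (v - m))
    calc _ ≤ (2 / r ^ 2 * Real.exp (r * ‖v - m‖)) / 4 * Real.exp (-(r * ‖v - m‖)) := by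
          gcongr; exact h3.trans h4
      _ = r⁻¹ ^ 2 / 2 * (Real.exp (r * ‖v - m‖) * Real.exp (-(r * ‖v - m‖))) := by
          field_simp; norm_num
      _ ≤ _ := by
          rw [← Real.exp_add, add_neg_cancel, Real.exp_zero]
          nlinarith [sq_nonneg r⁻¹]
  gcongr
  calc _ ≤ inner ℝ θ₀ v + r * ‖v‖ := inner_le_inner_add_of_norm_sub_le h v
    _ ≤ _ := by nlinarith [norm_nonneg v]

lemma integrable_dampedMoment (hs : Measurable s) (hr : 0 < r)
    (hI : Integrable (fun x => Real.exp (inner ℝ θ₀ (s x) + 4 * r * ‖s x‖)) lam)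
    {w : EuclideanSpace ℝ (Fin k)} (m : EuclideanSpace ℝ (Fin k))
    (hw : ‖w‖ ≤ 1) (h : ‖θ₁ - θ₀‖ ≤ r) :
    Integrable (fun x => Real.exp (inner ℝ θ₁ (s x)) *
      ((inner ℝ w (s x - m)) ^ 2 / 4 * Real.exp (-(r * ‖s x - m‖)))) lam :=
  (hI.const_mul (r⁻¹ ^ 2)).mono' (by fun_prop)
    (Filter.Eventually.of_forall fun x => norm_dampedMoment_integrand_le hr hw h (s x))

/-- The damping bounds the quadratic factor by `r⁻²`, so one integrable function dominates for all
parameters in the set. -/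
lemma continuousOn_dampedMoment (hs : Measurable s) (hr : 0 < r)
    (hI : Integrable (fun x => Real.exp (inner ℝ θ₀ (s x) + 4 * r * ‖s x‖)) lam) (R : ℝ) :
    ContinuousOn (dampedMoment lam s r)
      (Metric.sphere 0 1 ×ˢ (Metric.closedBall θ₀ r ×ˢ Metric.closedBall 0 R)) := by
  refine continuousOn_of_dominated
    (bound := fun x => r⁻¹ ^ 2 * Real.exp (inner ℝ θ₀ (s x) + 4 * r * ‖s x‖)) ?_ ?_
    (hI.const_mul _) ?_
  · rintro ⟨w, t, m⟩ -
    fun_prop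
  · rintro ⟨w, t, m⟩ ⟨hw, ht, -⟩
    refine Filter.Eventually.of_forall fun x => norm_dampedMoment_integrand_le hr ?_ ?_ _
    · simpa using hw.le
    · simpa [dist_eq_norm] using ht
  · refine Filter.Eventually.of_forall fun x => Continuous.continuousOn ?_
    fun_prop

lemma dampedMoment_pos (hs : Measurable s) (hr : 0 < r)
    (hI : Integrable (fun x => Real.exp (inner ℝ θ₀ (s x) + 4 * r * ‖s x‖)) lam)
    (hid : ∀ w m : EuclideanSpace ℝ (Fin k), w ≠ 0 → ¬ ∀ᵐ x ∂lam, inner ℝ w (s x - m) = 0)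
    {w : EuclideanSpace ℝ (Fin k)} (m : EuclideanSpace ℝ (Fin k))
    (hw : ‖w‖ = 1) (h : ‖θ₁ - θ₀‖ ≤ r) : 0 < dampedMoment lam s r (w, θ₁, m) := by
  refine lt_of_le_of_ne (integral_nonneg fun x => by dsimp; positivity) fun h0 => ?_
  refine hid w m (by rintro rfl; simp at hw) ?_
  have := (integral_eq_zero_iff_of_nonneg (fun x => by dsimp; positivity)
    (integrable_dampedMoment hs hr hI m hw.le h)).1 h0.symm
  filter_upwards [this] with x hx
  simpa [(Real.exp_pos _).ne'] using hx

lemma exists_le_dampedMoment (hs : Measurable s) (hr : 0 < r)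
    (hI : Integrable (fun x => Real.exp (inner ℝ θ₀ (s x) + 4 * r * ‖s x‖)) lam)
    (hid : ∀ w m : EuclideanSpace ℝ (Fin k), w ≠ 0 → ¬ ∀ᵐ x ∂lam, inner ℝ w (s x - m) = 0)
    (R : ℝ) : ∃ q > 0, ∀ w θ₁ m : EuclideanSpace ℝ (Fin k), ‖w‖ = 1 → ‖θ₁ - θ₀‖ ≤ r →
      ‖m‖ ≤ R → q ≤ dampedMoment lam s r (w, θ₁, m) := by
  have hK : IsCompact (Metric.sphere (0 : EuclideanSpace ℝ (Fin k)) 1 ×ˢ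
      (Metric.closedBall θ₀ r ×ˢ Metric.closedBall (0 : EuclideanSpace ℝ (Fin k)) R)) :=
    (isCompact_sphere _ _).prod ((isCompact_closedBall _ _).prod (isCompact_closedBall _ _))
  obtain ⟨q, hq, h⟩ := hK.exists_forall_le' (continuousOn_dampedMoment hs hr hI R) (a := 0) (by
    rintro ⟨w, t, m⟩ ⟨hw, ht, -⟩
    exact dampedMoment_pos hs hr hI hid m (by simpa using hw) (by simpa [dist_eq_norm] using ht))
  refine ⟨q, hq, fun w t m hw ht hm => h (w, t, m) ⟨by simpa using hw, ?_, by simpa using hm⟩⟩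
  simpa [dist_eq_norm] using ht

/-- Integrating `1 + t + t²/4 · exp(-|t|) ≤ exp t` at `t = ⟨θ - θ₁, s - m⟩` gives `1 + (q/z₁)‖θ -
θ₁‖² ≤ exp B`, with `q` the minimum from `exists_le_dampedMoment`. -/
lemma exists_mul_sq_le_bregman (hs : Measurable s) (hl : lam ≠ 0) (hr : 0 < r)
    (hI : Integrable (fun x => Real.exp (inner ℝ θ₀ (s x) + 4 * r * ‖s x‖)) lam)
    (hid : ∀ w m : EuclideanSpace ℝ (Fin k), w ≠ 0 → ¬ ∀ᵐ x ∂lam, inner ℝ w (s x - m) = 0) :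
    ∃ c > 0, ∀ θ₁ θ, ‖θ₁ - θ₀‖ ≤ r → ‖θ - θ₁‖ ≤ r →
      c * ‖θ - θ₁‖ ^ 2 ≤ bregman lam s θ θ₁ := by
  obtain ⟨z₀, z₁, hz, hb⟩ := exists_partition_bounds hs hl hr hI
  obtain ⟨R, hR⟩ := exists_norm_mean_le hs hl hr hI
  obtain ⟨q, hq, hqle⟩ := exists_le_dampedMoment hs hr hI hid R
  have hz₁ : 0 < z₁ := hz.trans_le ((hb θ₀ (by simpa using hr.le)).1.trans
    (hb θ₀ (by simpa using hr.le)).2)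
  -- The constant comes from `log(1 + y) ≥ y / (1 + y)` with `y = (q/z₁)‖u‖²` and `‖u‖ ≤ r`.
  refine ⟨(q / z₁) / (1 + q / z₁ * r ^ 2), by positivity, fun θ₁ θ h₁ hu => ?_⟩
  have hθ₁ : θ₁ ∈ domain lam s := mem_domain_of_norm_sub_le hs hI (by linarith)
  have hθ : θ ∈ domain lam s := mem_domain_of_norm_sub_le hs hI (by
    have := norm_add_le (θ - θ₁) (θ₁ - θ₀)
    rw [sub_add_sub_cancel] at this
    linarith)
  have hθ₁' : Integrable (fun x => Real.exp (inner ℝ θ₁ (s x))) lam := hθ₁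
  set m := mean lam s θ₁ with hm
  set u := θ - θ₁ with hudef
  rcases eq_or_ne u 0 with hu0 | hu0
  · have : θ = θ₁ := sub_eq_zero.1 hu0
    simp [bregman, hu0, this]
  have hn : 0 < ‖u‖ := norm_pos_iff.2 hu0
  set w := ‖u‖⁻¹ • u with hw
  have huw : u = ‖u‖ • w := by rw [hw, smul_smul, mul_inv_cancel₀ hn.ne', one_smul]
  have hw1 : ‖w‖ = 1 := by rw [hw, norm_smul, norm_inv, norm_norm, inv_mul_cancel₀ hn.ne']
  obtain ⟨h1, h2⟩ := integral_exp_mul_inner_sub_mean hl hθ₁ (integrable_exp_smul hs hr hI h₁) u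
  obtain ⟨h3, h4⟩ := integral_exp_mul_exp_inner_sub_mean hl hθ₁ hθ
  have h5 := integrable_dampedMoment hs hr hI m hw1.le h₁
  have h6 := integral_mono ((hθ₁'.add h1).add (h5.const_mul (‖u‖ ^ 2))) h3 fun x => by
    simp only [Pi.add_apply]
    rw [← hm, ← hudef]
    have e1 := one_add_add_sq_mul_exp_le_exp (inner ℝ u (s x - m))
    have e2 : Real.exp (-(r * ‖s x - m‖)) ≤ Real.exp (-|inner ℝ u (s x - m)|) :=
      Real.exp_le_exp.2 (neg_le_neg ((abs_real_inner_le_norm _ _).trans (by gcongr)))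
    have e3 : ‖u‖ ^ 2 * ((inner ℝ w (s x - m)) ^ 2 / 4 * Real.exp (-(r * ‖s x - m‖))) ≤
        (inner ℝ u (s x - m)) ^ 2 / 4 * Real.exp (-|inner ℝ u (s x - m)|) := by
      have : inner ℝ u (s x - m) ^ 2 = ‖u‖ ^ 2 * (inner ℝ w (s x - m)) ^ 2 := by
        conv_lhs => rw [huw, real_inner_smul_left, mul_pow]
      calc _ = inner ℝ u (s x - m) ^ 2 / 4 * Real.exp (-(r * ‖s x - m‖)) := by
            rw [this]; ring
        _ ≤ _ := by gcongr
    have e4 := Real.exp_pos (inner ℝ θ₁ (s x))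
    calc _ = Real.exp (inner ℝ θ₁ (s x)) * (1 + inner ℝ u (s x - m) +
          ‖u‖ ^ 2 * ((inner ℝ w (s x - m)) ^ 2 / 4 * Real.exp (-(r * ‖s x - m‖)))) := by ring
      _ ≤ _ := by gcongr; linarith
  rw [integral_add' (hθ₁'.add h1) (h5.const_mul _), integral_add' hθ₁' h1, h2, h4, add_zero,
    integral_const_mul] at h6
  have h7 : q ≤ _ := hqle w θ₁ m hw1 h₁ (hR θ₁ h₁)
  rw [dampedMoment] at h7
  have hZ := hb θ₁ h₁
  have hZ0 := hz.trans_le hZ.1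
  have h8 : 1 + q / z₁ * ‖u‖ ^ 2 ≤ Real.exp (bregman lam s θ θ₁) := by
    rw [← partition] at h6
    have h9 : partition lam s θ₁ + ‖u‖ ^ 2 * q ≤
        partition lam s θ₁ * Real.exp (bregman lam s θ θ₁) :=
      le_trans (by gcongr) h6
    calc 1 + q / z₁ * ‖u‖ ^ 2 ≤ 1 + q / partition lam s θ₁ * ‖u‖ ^ 2 := by
          gcongr; exact hZ.2
      _ = (partition lam s θ₁ + ‖u‖ ^ 2 * q) / partition lam s θ₁ := by field_simp
      _ ≤ _ := by rw [div_le_iff₀ hZ0]; linarith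
  have ha : 0 < q / z₁ := by positivity
  have h11 : Real.log (1 + q / z₁ * ‖u‖ ^ 2) ≤ bregman lam s θ θ₁ :=
    (Real.log_le_iff_le_exp (by positivity)).2 h8
  have h12 := Real.one_sub_inv_le_log_of_pos (x := 1 + q / z₁ * ‖u‖ ^ 2) (by positivity)
  refine le_trans ?_ (h12.trans h11)
  calc q / z₁ / (1 + q / z₁ * r ^ 2) * ‖u‖ ^ 2 ≤ q / z₁ / (1 + q / z₁ * ‖u‖ ^ 2) * ‖u‖ ^ 2 := by
        gcongr
    _ = _ := by field_simp; ring

lemma exists_bregman_le_mul_sq (hs : Measurable s) (hl : lam ≠ 0) (hr : 0 < r)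
    (hI : Integrable (fun x => Real.exp (inner ℝ θ₀ (s x) + 4 * r * ‖s x‖)) lam) :
    ∃ L > 0, ∀ θ₁ θ, ‖θ₁ - θ₀‖ ≤ r → ‖θ - θ₁‖ ≤ r →
      bregman lam s θ θ₁ ≤ L * ‖θ - θ₁‖ ^ 2 := by
  obtain ⟨z₀, z₁, hz, hb⟩ := exists_partition_bounds hs hl hr hI
  obtain ⟨R, hR⟩ := exists_norm_mean_le hs hl hr hI
  have : NeZero lam := ⟨hl⟩
  -- `2/r²` is the cost of absorbing `‖s - m‖²` into `exp(r‖s - m‖)`; `exp(2rR)` pays for replacing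
  -- `‖s - m‖` by `‖s‖ + R` in two such exponentials.
  set B := 2 / r ^ 2 * Real.exp (2 * r * R) *
    ∫ x, Real.exp (inner ℝ θ₀ (s x) + 4 * r * ‖s x‖) ∂lam with hB
  have hB0 : 0 < B := mul_pos (by positivity) (integral_exp_pos hI)
  refine ⟨B / z₀, by positivity, fun θ₁ θ h₁ hu => ?_⟩
  have hθ₁ : θ₁ ∈ domain lam s := mem_domain_of_norm_sub_le hs hI (by linarith)
  have hθ : θ ∈ domain lam s := mem_domain_of_norm_sub_le hs hI (by
    have := norm_add_le (θ - θ₁) (θ₁ - θ₀)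
    rw [sub_add_sub_cancel] at this
    linarith)
  have hθ₁' : Integrable (fun x => Real.exp (inner ℝ θ₁ (s x))) lam := hθ₁
  set m := mean lam s θ₁ with hm
  set u := θ - θ₁ with hudef
  obtain ⟨h1, h2⟩ := integral_exp_mul_inner_sub_mean hl hθ₁ (integrable_exp_smul hs hr hI h₁) u
  obtain ⟨h3, h4⟩ := integral_exp_mul_exp_inner_sub_mean hl hθ₁ hθ
  have h5 := hI.const_mul (‖u‖ ^ 2 * (2 / r ^ 2 * Real.exp (2 * r * R)))
  have h6 := integral_mono h3 ((hθ₁'.add h1).add h5) fun x => by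
    simp only [Pi.add_apply]
    rw [← hm, ← hudef]
    have e1 := exp_le_one_add_add_sq_mul_exp (inner ℝ u (s x - m))
    have e2 : Real.exp |inner ℝ u (s x - m)| ≤ Real.exp (r * ‖s x - m‖) :=
      Real.exp_le_exp.2 ((abs_real_inner_le_norm _ _).trans (by gcongr))
    have e3 : inner ℝ u (s x - m) ^ 2 ≤ ‖u‖ ^ 2 * ‖s x - m‖ ^ 2 := by
      rw [← mul_pow, ← sq_abs]
      gcongr
      exact abs_real_inner_le_norm _ _
    have e4 := sq_le_exp_div hr (norm_nonneg (s x - m))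
    have e5 : ‖s x - m‖ ≤ ‖s x‖ + R := (norm_sub_le _ _).trans (by gcongr; exact hR θ₁ h₁)
    calc Real.exp (inner ℝ θ₁ (s x)) * Real.exp (inner ℝ u (s x - m)) ≤
        Real.exp (inner ℝ θ₁ (s x)) * (1 + inner ℝ u (s x - m) +
          ‖u‖ ^ 2 * (2 / r ^ 2 * Real.exp (r * ‖s x - m‖)) * Real.exp (r * ‖s x - m‖)) := by
          gcongr
          refine e1.trans ?_
          gcongr
          exact e3.trans (by gcongr)
      _ = Real.exp (inner ℝ θ₁ (s x)) + Real.exp (inner ℝ θ₁ (s x)) * inner ℝ u (s x - m) +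
          ‖u‖ ^ 2 * (2 / r ^ 2) *
            Real.exp (inner ℝ θ₁ (s x) + r * ‖s x - m‖ + r * ‖s x - m‖) := by
          rw [Real.exp_add, Real.exp_add]; ring
      _ ≤ Real.exp (inner ℝ θ₁ (s x)) + Real.exp (inner ℝ θ₁ (s x)) * inner ℝ u (s x - m) +
          ‖u‖ ^ 2 * (2 / r ^ 2) *
            Real.exp (2 * r * R + (inner ℝ θ₀ (s x) + 4 * r * ‖s x‖)) := by
          have := inner_le_inner_add_of_norm_sub_le h₁ (s x)
          refine add_le_add le_rfl
            (mul_le_mul_of_nonneg_left (Real.exp_le_exp.2 ?_) (by positivity))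
          nlinarith [norm_nonneg (s x), mul_le_mul_of_nonneg_left e5 hr.le,
            mul_nonneg hr.le (norm_nonneg (s x))]
      _ = _ := by rw [Real.exp_add (2 * r * R)]; ring
  rw [integral_add' (hθ₁'.add h1) h5, integral_add' hθ₁' h1, h2, h4, add_zero,
    integral_const_mul, ← partition, mul_assoc (‖u‖ ^ 2), ← hB] at h6
  have hZ := hb θ₁ h₁
  have hZ0 := hz.trans_le hZ.1
  have h7 : Real.exp (bregman lam s θ θ₁) ≤ 1 + B / z₀ * ‖u‖ ^ 2 := by
    calc _ ≤ (partition lam s θ₁ + ‖u‖ ^ 2 * B) / partition lam s θ₁ := by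
          rw [le_div_iff₀ hZ0]; linarith
      _ = 1 + B / partition lam s θ₁ * ‖u‖ ^ 2 := by field_simp
      _ ≤ _ := by gcongr; exact hZ.1
  linarith [Real.add_one_le_exp (bregman lam s θ θ₁)]

/-- Convexity: weight by `t` and `1 - t` the nonnegative divergences of `θ` and `θ₁` from the
intermediate point; the terms with its mean cancel. -/
lemma bregman_add_smul_le (hs : Measurable s) (hl : lam ≠ 0) (ho : IsOpen (domain lam s))
    (hθ₁ : θ₁ ∈ domain lam s) (hθ : θ ∈ domain lam s) {t : ℝ} (ht : 0 ≤ t) (ht1 : t ≤ 1)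
    (hm : θ₁ + t • (θ - θ₁) ∈ domain lam s) :
    bregman lam s (θ₁ + t • (θ - θ₁)) θ₁ ≤ t * bregman lam s θ θ₁ := by
  have h1 := bregman_nonneg hs hl ho hm hθ
  have h2 := bregman_nonneg hs hl ho hm hθ₁
  simp only [bregman] at *
  set M := mean lam s (θ₁ + t • (θ - θ₁))
  have e1 : θ - (θ₁ + t • (θ - θ₁)) = (1 - t) • (θ - θ₁) := by module
  have e2 : θ₁ - (θ₁ + t • (θ - θ₁)) = (-t) • (θ - θ₁) := by module
  rw [e1, real_inner_smul_right] at h1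
  rw [e2, real_inner_smul_right] at h2
  rw [add_sub_cancel_left, real_inner_smul_right]
  nlinarith [mul_nonneg ht h1, mul_nonneg (sub_nonneg.2 ht1) h2]

/-- Two-sided quadratic bounds on the Bregman divergence, uniform near a parameter, together with
the linear growth of the lower bound away from it. -/
theorem exists_local_bregman_bounds (hs : Measurable s) (hl : lam ≠ 0)
    (ho : IsOpen (domain lam s))
    (hid : ∀ w m : EuclideanSpace ℝ (Fin k), w ≠ 0 → ¬ ∀ᵐ x ∂lam, inner ℝ w (s x - m) = 0)
    (hθ₀ : θ₀ ∈ domain lam s) :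
    ∃ r > 0, ∃ c > 0, ∃ L > 0, ∀ θ₁, ‖θ₁ - θ₀‖ ≤ r → θ₁ ∈ domain lam s ∧
      (∀ θ ∈ domain lam s,
        c * (‖θ - θ₁‖ * min ‖θ - θ₁‖ r) ≤ bregman lam s θ θ₁) ∧
      (∀ θ, ‖θ - θ₁‖ ≤ r → θ ∈ domain lam s ∧ bregman lam s θ θ₁ ≤ L * ‖θ - θ₁‖ ^ 2) := by
  obtain ⟨r, hr, hI⟩ := exists_integrable_exp_inner_add_norm hs ho hθ₀
  obtain ⟨c, hc, hlo⟩ := exists_mul_sq_le_bregman hs hl hr hI hid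
  obtain ⟨L, hL, hup⟩ := exists_bregman_le_mul_sq hs hl hr hI
  have hmem : ∀ θ₁ θ, ‖θ₁ - θ₀‖ ≤ r → ‖θ - θ₁‖ ≤ r → θ ∈ domain lam s := by
    intro θ₁ θ h₁ hu
    refine mem_domain_of_norm_sub_le hs hI ?_
    have := norm_add_le (θ - θ₁) (θ₁ - θ₀)
    rw [sub_add_sub_cancel] at this
    linarith
  refine ⟨r, hr, c, hc, L, hL, fun θ₁ h₁ => ?_⟩
  have hθ₁ := hmem θ₁ θ₁ h₁ (by simpa using hr.le)
  refine ⟨hθ₁, fun θ hθ => ?_, fun θ hu => ⟨hmem _ _ h₁ hu, hup _ _ h₁ hu⟩⟩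
  rcases le_total ‖θ - θ₁‖ r with h | h
  · rw [min_eq_left h, ← sq]
    exact hlo _ _ h₁ h
  · rw [min_eq_right h]
    have hn : 0 < ‖θ - θ₁‖ := hr.trans_le h
    -- The quadratic bound at distance `r` on the segment to `θ` propagates outwards linearly by
    -- convexity.
    have hnorm : ‖θ₁ + (r / ‖θ - θ₁‖) • (θ - θ₁) - θ₁‖ = r := by
      rw [add_sub_cancel_left, norm_smul, Real.norm_of_nonneg (by positivity),
        div_mul_cancel₀ _ hn.ne']
    have h1 := hlo _ _ h₁ hnorm.le
    have h2 := bregman_add_smul_le hs hl ho hθ₁ hθ (t := r / ‖θ - θ₁‖) (by positivity)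
      ((div_le_one hn).2 h) (hmem _ _ h₁ hnorm.le)
    rw [hnorm] at h1
    have h3 := h1.trans h2
    rw [div_mul_eq_mul_div, le_div_iff₀ hn] at h3
    refine le_of_mul_le_mul_left ?_ hr
    linarith

end LocalBounds

/-! ### Laplace integrals under two-sided growth bounds -/

section Laplace

lemma ofReal_rpow_mul_lintegral_sqrt_smul_sub {k : ℕ} {N : ℝ} (hN : 0 < N)
    (θ₁ : EuclideanSpace ℝ (Fin k)) {f : EuclideanSpace ℝ (Fin k) → ENNReal}
    (hf : Measurable f) :
    ENNReal.ofReal (N ^ ((k : ℝ) / 2)) * ∫⁻ θ, f (√N • (θ - θ₁)) = ∫⁻ v, f v := by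
  have hs : √N ≠ 0 := (Real.sqrt_pos.2 hN).ne'
  rw [lintegral_sub_right_eq_self (fun θ => f (√N • θ)) θ₁,
    ← lintegral_map (f := f) hf (measurable_const_smul (√N)), Measure.map_addHaar_smul _ hs,
    lintegral_smul_measure, finrank_euclideanSpace, Fintype.card_fin, smul_eq_mul, ← mul_assoc,
    ← ENNReal.ofReal_mul (by positivity)]
  have : N ^ ((k : ℝ) / 2) * |((√N) ^ k)⁻¹| = 1 := by
    rw [abs_of_nonneg (by positivity), Real.sqrt_eq_rpow, ← Real.rpow_natCast, ← Real.rpow_mul hN.le,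
      show (1 / 2 : ℝ) * k = k / 2 by ring]
    exact mul_inv_cancel₀ (Real.rpow_pos_of_pos hN _).ne'
  rw [this, ENNReal.ofReal_one, one_mul]

lemma lintegral_exp_sub_norm_lt_top (k : ℕ) (a : ℝ) {b : ℝ} (hb : 0 < b) :
    ∫⁻ v : EuclideanSpace ℝ (Fin k), ENNReal.ofReal (Real.exp (a - b * ‖v‖)) < ⊤ := by
  have hint := integrable_one_add_norm (E := EuclideanSpace ℝ (Fin k)) (μ := volume)
    (r := (k + 1 : ℝ)) (by simp)
  set M : ℝ := Real.exp a * ((k + 1).factorial * (b⁻¹) ^ (k + 1) * Real.exp b) with hM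
  have hint2 := hint.const_mul M
  refine lt_of_le_of_lt (lintegral_mono fun v => ENNReal.ofReal_le_ofReal ?_)
    (hint2.lintegral_lt_top)
  have ht : 0 < 1 + ‖v‖ := by positivity
  have h1 := Real.pow_div_factorial_le_exp (b * (1 + ‖v‖)) (by positivity) (k + 1)
  have h2 : (1 + ‖v‖) ^ (-(k + 1 : ℝ)) = ((1 + ‖v‖) ^ (k + 1))⁻¹ := by
    rw [Real.rpow_neg ht.le]
    norm_cast
  rw [h2, hM, ← div_eq_mul_inv, le_div_iff₀ (by positivity), sub_eq_add_neg, Real.exp_add, mul_assoc]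
  refine mul_le_mul_of_nonneg_left ?_ (Real.exp_pos a).le
  have hbp : 0 < b ^ (k + 1) := by positivity
  have h3 : (1 + ‖v‖) ^ (k + 1) ≤
      (k + 1).factorial * (b⁻¹) ^ (k + 1) * Real.exp (b * (1 + ‖v‖)) := by
    rw [div_le_iff₀ (by positivity), mul_pow] at h1
    rw [inv_pow, mul_assoc, mul_left_comm, ← div_eq_inv_mul, le_div_iff₀ hbp]
    linarith
  calc Real.exp (-(b * ‖v‖)) * (1 + ‖v‖) ^ (k + 1) ≤ Real.exp (-(b * ‖v‖)) *
        ((k + 1).factorial * (b⁻¹) ^ (k + 1) * Real.exp (b * (1 + ‖v‖))) := by gcongr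
    _ = (k + 1).factorial * (b⁻¹) ^ (k + 1) *
        (Real.exp (-(b * ‖v‖)) * Real.exp (b * (1 + ‖v‖))) := by ring
    _ = _ := by rw [← Real.exp_add]; ring_nf

variable {k : ℕ} {Θ : Set (EuclideanSpace ℝ (Fin k))}
  {D : EuclideanSpace ℝ (Fin k) → EuclideanSpace ℝ (Fin k) → ℝ} {r c L ν : ℝ}

/-- After the scaling `v = √N(θ - θ₁)`, both growth regimes lie above the single affine function
`b‖v‖ - b²` with `b = r√ν`, because `N ≥ ν`. This gives an integrable majorant free of `N`. -/
lemma laplace_upper (hΘ : MeasurableSet Θ) (hr : 0 < r) (hc : 0 < c) (hν : 0 < ν) :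
    ∃ C : ℝ, ∀ θ₁, (∀ θ ∈ Θ, c * (‖θ - θ₁‖ * min ‖θ - θ₁‖ r) ≤ D θ θ₁) → ∀ N, ν ≤ N →
      ENNReal.ofReal (N ^ ((k : ℝ) / 2)) *
        ∫⁻ θ in Θ, ENNReal.ofReal (Real.exp (-(N * D θ θ₁))) ≤ ENNReal.ofReal C := by
  have hfin := lintegral_exp_sub_norm_lt_top k (c * (r * √ν) ^ 2)
    (show 0 < c * (r * √ν) by positivity)
  refine ⟨(∫⁻ v : EuclideanSpace ℝ (Fin k), ENNReal.ofReal
    (Real.exp (c * (r * √ν) ^ 2 - c * (r * √ν) * ‖v‖))).toReal, fun θ₁ h N hN => ?_⟩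
  have hN0 := hν.trans_le hN
  rw [ENNReal.ofReal_toReal hfin.ne,
    ← ofReal_rpow_mul_lintegral_sqrt_smul_sub hN0 θ₁ (by fun_prop)]
  refine mul_le_mul' le_rfl ?_
  refine (setLIntegral_mono' hΘ fun θ hθ => ?_).trans (setLIntegral_le_lintegral _ _)
  refine ENNReal.ofReal_le_ofReal (Real.exp_le_exp.2 ?_)
  rw [norm_smul, Real.norm_of_nonneg (Real.sqrt_nonneg _)]
  have hle : √ν ≤ √N := Real.sqrt_le_sqrt hN
  have hsN : √N * √N = N := Real.mul_self_sqrt hN0.le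
  have hs0 : 0 < √N := Real.sqrt_pos.2 hN0
  set u := ‖θ - θ₁‖ with hu
  have hu0 : 0 ≤ u := norm_nonneg _
  have h1 : N * (c * (u * min u r)) ≤ N * D θ θ₁ := by gcongr; exact h θ hθ
  have h2 : (r * √ν) * (√N * u) - (r * √ν) ^ 2 ≤ N * (u * min u r) := by
    rcases le_total u r with hur | hur
    · rw [min_eq_left hur]
      have : N * (u * u) = (√N * u) ^ 2 := by rw [mul_pow, Real.sq_sqrt hN0.le]; ring
      rw [this]
      nlinarith [sq_nonneg (√N * u - r * √ν), sq_nonneg (√N * u), sq_nonneg (r * √ν)]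
    · rw [min_eq_right hur]
      have : (r * √ν) * (√N * u) ≤ (r * √N) * (√N * u) := by gcongr
      have h3 : N * (u * r) = (r * √N) * (√N * u) := by linear_combination -(u * r) * hsN
      rw [h3]
      linarith [sq_nonneg (r * √ν)]
  nlinarith [mul_le_mul_of_nonneg_left h2 hc.le]

/-- Only the rescaled ball of radius `r√ν` is kept: since `N ≥ ν`, it stays within distance `r` of
`θ₁`, where the quadratic bound holds. -/
lemma laplace_lower (hr : 0 < r) (hL : 0 < L) (hν : 0 < ν) (hΘ : MeasurableSet Θ) :
    ∃ C > 0, ∀ θ₁, (∀ θ, ‖θ - θ₁‖ ≤ r → θ ∈ Θ ∧ D θ θ₁ ≤ L * ‖θ - θ₁‖ ^ 2) → ∀ N, ν ≤ N →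
      ENNReal.ofReal C ≤ ENNReal.ofReal (N ^ ((k : ℝ) / 2)) *
        ∫⁻ θ in Θ, ENNReal.ofReal (Real.exp (-(N * D θ θ₁))) := by
  set b := r * √ν with hb
  have hb0 : 0 < b := by positivity
  have hV : volume (Metric.closedBall (0 : EuclideanSpace ℝ (Fin k)) b) ≠ ⊤ :=
    measure_closedBall_lt_top.ne
  have hV0 : 0 < volume (Metric.closedBall (0 : EuclideanSpace ℝ (Fin k)) b) :=
    Metric.measure_closedBall_pos _ _ hb0
  refine ⟨Real.exp (-(L * b ^ 2)) *
    (volume (Metric.closedBall (0 : EuclideanSpace ℝ (Fin k)) b)).toReal,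
    mul_pos (Real.exp_pos _) (ENNReal.toReal_pos hV0.ne' hV), fun θ₁ h N hN => ?_⟩
  have hN0 := hν.trans_le hN
  have hs0 : 0 < √N := Real.sqrt_pos.2 hN0
  rw [ENNReal.ofReal_mul (Real.exp_pos _).le, ENNReal.ofReal_toReal hV,
    ← lintegral_indicator_const Metric.isClosed_closedBall.measurableSet,
    ← ofReal_rpow_mul_lintegral_sqrt_smul_sub hN0 θ₁
      (measurable_const.indicator Metric.isClosed_closedBall.measurableSet),
    ← lintegral_indicator hΘ]
  gcongr with θ
  by_cases hθ : √N • (θ - θ₁) ∈ Metric.closedBall (0 : EuclideanSpace ℝ (Fin k)) b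
  · rw [Set.indicator_of_mem hθ]
    rw [mem_closedBall_zero_iff, norm_smul, Real.norm_of_nonneg hs0.le] at hθ
    have hur : ‖θ - θ₁‖ ≤ r := by
      have : r * √ν ≤ r * √N := by gcongr
      refine le_of_mul_le_mul_left ?_ hs0
      linarith
    obtain ⟨h1, h2⟩ := h θ hur
    rw [Set.indicator_of_mem h1]
    refine ENNReal.ofReal_le_ofReal (Real.exp_le_exp.2 (neg_le_neg ?_))
    calc N * D θ θ₁ ≤ N * (L * ‖θ - θ₁‖ ^ 2) := by gcongr
      _ = L * (√N * ‖θ - θ₁‖) ^ 2 := by rw [mul_pow, Real.sq_sqrt hN0.le]; ring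
      _ ≤ L * b ^ 2 := by gcongr
  · rw [Set.indicator_of_notMem hθ]
    exact zero_le

end Laplace

/-! ### Uniformity over compact sets of means -/

section Compact

variable {Ω : Type*} [MeasurableSpace Ω] {k : ℕ} {lam : Measure Ω}
  {s : Ω → EuclideanSpace ℝ (Fin k)}

/-- The normalised Laplace integral of the family at the parameter `θ₁` with sample size `N`. -/
def laplaceIntegral (lam : Measure Ω) (s : Ω → EuclideanSpace ℝ (Fin k)) (N : ℝ)
    (θ₁ : EuclideanSpace ℝ (Fin k)) : ENNReal :=
  ENNReal.ofReal (N ^ ((k : ℝ) / 2)) *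
    ∫⁻ θ in domain lam s, ENNReal.ofReal (Real.exp (-(N * bregman lam s θ θ₁)))

theorem exists_local_laplaceIntegral_bounds (hs : Measurable s) (hl : lam ≠ 0)
    (ho : IsOpen (domain lam s))
    (hid : ∀ w m : EuclideanSpace ℝ (Fin k), w ≠ 0 → ¬ ∀ᵐ x ∂lam, inner ℝ w (s x - m) = 0)
    {ν : ℝ} (hν : 0 < ν) {θ₀ : EuclideanSpace ℝ (Fin k)} (hθ₀ : θ₀ ∈ domain lam s) :
    ∃ ε > 0, ∃ C₁ C₂ : ℝ, 0 < C₁ ∧ ∀ θ₁ ∈ domain lam s,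
      ‖mean lam s θ₁ - mean lam s θ₀‖ < ε → ∀ N, ν ≤ N →
        ENNReal.ofReal C₁ ≤ laplaceIntegral lam s N θ₁ ∧
          laplaceIntegral lam s N θ₁ ≤ ENNReal.ofReal C₂ := by
  obtain ⟨r, hr, c, hc, L, hL, h⟩ := exists_local_bregman_bounds hs hl ho hid hθ₀
  obtain ⟨C₂, hC₂⟩ := laplace_upper (D := bregman lam s) ho.measurableSet hr hc hν
  obtain ⟨C₁, hC₁, hlo⟩ := laplace_lower (D := bregman lam s) hr hL hν ho.measurableSet
  refine ⟨c * r, by positivity, C₁, C₂, hC₁, fun θ₁ hθ₁ hm N hN => ?_⟩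
  -- Otherwise linear growth and Cauchy–Schwarz give `c r ‖θ₁ - θ₀‖ ≤ ‖mean θ₁ - mean θ₀‖ ‖θ₁ -
  -- θ₀‖`, against the choice `ε = c r`.
  have hnear : ‖θ₁ - θ₀‖ ≤ r := by
    by_contra! hgt
    have h1 := (h θ₀ (by simpa using hr.le)).2.1 θ₁ hθ₁
    have h2 := bregman_nonneg hs hl ho hθ₁ hθ₀
    rw [min_eq_right hgt.le] at h1
    have h3 : bregman lam s θ₁ θ₀ + bregman lam s θ₀ θ₁ =
        inner ℝ (mean lam s θ₁ - mean lam s θ₀) (θ₁ - θ₀) := by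
      simp only [bregman, inner_sub_left, inner_sub_right]; ring
    have h4 := real_inner_le_norm (mean lam s θ₁ - mean lam s θ₀) (θ₁ - θ₀)
    nlinarith [mul_lt_mul_of_pos_right hm (hr.trans hgt)]
  obtain ⟨-, h1, h2⟩ := h θ₁ hnear
  exact ⟨hlo θ₁ h2 N hN, hC₂ θ₁ h1 N hN⟩

theorem exists_laplaceIntegral_bounds_of_isCompact (hs : Measurable s) (hl : lam ≠ 0)
    (ho : IsOpen (domain lam s))
    (hid : ∀ w m : EuclideanSpace ℝ (Fin k), w ≠ 0 → ¬ ∀ᵐ x ∂lam, inner ℝ w (s x - m) = 0)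
    {ν : ℝ} (hν : 0 < ν) {U : Set (EuclideanSpace ℝ (Fin k))} (hU : IsCompact U)
    (hUM : U ⊆ mean lam s '' domain lam s) :
    ∃ C₁ C₂ : ℝ, 0 < C₁ ∧ C₁ ≤ C₂ ∧ ∀ θ₁ ∈ domain lam s, mean lam s θ₁ ∈ U → ∀ N, ν ≤ N →
      ENNReal.ofReal C₁ ≤ laplaceIntegral lam s N θ₁ ∧
        laplaceIntegral lam s N θ₁ ≤ ENNReal.ofReal C₂ := by
  refine hU.induction_on (p := fun S => ∃ C₁ C₂ : ℝ, 0 < C₁ ∧ C₁ ≤ C₂ ∧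
    ∀ θ₁ ∈ domain lam s, mean lam s θ₁ ∈ S → ∀ N, ν ≤ N →
      ENNReal.ofReal C₁ ≤ laplaceIntegral lam s N θ₁ ∧
        laplaceIntegral lam s N θ₁ ≤ ENNReal.ofReal C₂) ?_ ?_ ?_ ?_
  · exact ⟨1, 1, one_pos, le_rfl, fun _ _ h => h.elim⟩
  · rintro S T hST ⟨C₁, C₂, h1, h2, h⟩
    exact ⟨C₁, C₂, h1, h2, fun θ hθ hm => h θ hθ (hST hm)⟩
  · rintro S T ⟨A₁, A₂, h1, h2, h⟩ ⟨B₁, B₂, h1', h2', h'⟩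
    refine ⟨min A₁ B₁, max A₂ B₂, lt_min h1 h1', (min_le_left _ _).trans
      (h2.trans (le_max_left _ _)), ?_⟩
    rintro θ hθ (hm | hm) N hN
    · exact ⟨(ENNReal.ofReal_le_ofReal (min_le_left _ _)).trans (h θ hθ hm N hN).1,
        (h θ hθ hm N hN).2.trans (ENNReal.ofReal_le_ofReal (le_max_left _ _))⟩
    · exact ⟨(ENNReal.ofReal_le_ofReal (min_le_right _ _)).trans (h' θ hθ hm N hN).1,
        (h' θ hθ hm N hN).2.trans (ENNReal.ofReal_le_ofReal (le_max_right _ _))⟩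
  · intro μ hμ
    obtain ⟨θ₀, hθ₀, rfl⟩ := hUM hμ
    obtain ⟨ε, hε, C₁, C₂, hC, h⟩ := exists_local_laplaceIntegral_bounds hs hl ho hid hν hθ₀
    refine ⟨Metric.ball (mean lam s θ₀) ε, mem_nhdsWithin_of_mem_nhds (Metric.ball_mem_nhds _ hε),
      C₁, max C₁ C₂, hC, le_max_left _ _, fun θ hθ hm N hN => ?_⟩
    have := h θ hθ (by simpa [dist_eq_norm] using hm) N hN
    exact ⟨this.1, this.2.trans (ENNReal.ofReal_le_ofReal (le_max_right _ _))⟩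

end Compact

/-! ### From extended-real definitions to the real-valued Laplace integral -/

section Translation

variable {d k : ℕ} {F : ExpFamily d k} {θ θ₁ : EuclideanSpace ℝ (Fin k)}

lemma domain_eq (hF : F.Regularity) : domain F.lam F.s = F.Θ := by
  have hs := F.measurable_s
  ext θ
  rw [hF.full, Set.mem_ofPred_eq, kappa, ENNReal.log_lt_top_iff, domain, Set.mem_ofPred_eq]
  refine ⟨fun h => h.lintegral_lt_top, fun h => ⟨by fun_prop, ?_⟩⟩
  rwa [hasFiniteIntegral_iff_ofReal (Filter.Eventually.of_forall fun x => (Real.exp_pos _).le)]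

lemma kappa_eq (hθ : θ ∈ domain F.lam F.s) : F.kappa θ = (cumulant F.lam F.s θ : EReal) := by
  rw [kappa, ← ofReal_integral_eq_lintegral_ofReal hθ
    (Filter.Eventually.of_forall fun x => (Real.exp_pos _).le)]
  exact ENNReal.log_ofReal_of_pos (partition_pos F.lam_ne_zero hθ)

lemma density_eq (hθ : θ ∈ domain F.lam F.s) (x : F.X) : F.density θ x =
    ENNReal.ofReal (Real.exp (inner ℝ θ (F.s x) - cumulant F.lam F.s θ)) := by
  rw [density, kappa_eq hθ, ← EReal.coe_sub, EReal.exp_coe]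

lemma integral_P_eq_mean (hθ : θ ∈ domain F.lam F.s) :
    ∫ x, F.s x ∂F.P θ = mean F.lam F.s θ := by
  have hs := F.measurable_s
  have hd : F.density θ = fun x =>
      ENNReal.ofReal (Real.exp (inner ℝ θ (F.s x) - cumulant F.lam F.s θ)) :=
    funext fun x => density_eq hθ x
  have hZ := partition_pos F.lam_ne_zero hθ
  rw [P, hd, integral_withDensity_eq_integral_toReal_smul (by fun_prop)
    (Filter.Eventually.of_forall fun x => ENNReal.ofReal_lt_top), mean, ← integral_smul]
  congr 1 with x
  rw [ENNReal.toReal_ofReal (Real.exp_pos _).le, smul_smul, Real.exp_sub, cumulant,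
    Real.exp_log hZ, div_eq_inv_mul]

lemma momentSpace_eq (hF : F.Regularity) :
    F.momentSpace = mean F.lam F.s '' domain F.lam F.s := by
  ext μ
  rw [momentSpace, Set.mem_ofPred_eq, ← domain_eq hF]
  constructor
  · rintro ⟨θ, hθ, rfl⟩
    exact ⟨θ, hθ, (integral_P_eq_mean hθ).symm⟩
  · rintro ⟨θ, hθ, rfl⟩
    exact ⟨θ, hθ, (integral_P_eq_mean hθ).symm⟩

/-- If `s` lay in a hyperplane almost everywhere, moving `θ` along its normal would add a constant
to `⟨θ, s⟩`, which `κ` absorbs, contradicting identifiability. -/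
lemma not_ae_inner_sub_eq_zero (hF : F.Regularity) (w m : EuclideanSpace ℝ (Fin k)) (hw : w ≠ 0) :
    ¬ ∀ᵐ x ∂F.lam, inner ℝ w (F.s x - m) = 0 := by
  intro h
  obtain ⟨θ, hθ⟩ := hF.nonempty
  have hcont : Continuous fun t : ℝ => θ + t • w := by fun_prop
  have hnear : ∀ᶠ t in nhds (0 : ℝ), θ + t • w ∈ F.Θ :=
    hcont.continuousAt.eventually_mem (hF.regular.mem_nhds (by simpa using hθ))
  obtain ⟨ε, hε, hb⟩ := Metric.eventually_nhds_iff.1 hnear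
  have ht : θ + (ε / 2) • w ∈ F.Θ := hb (by
    rw [dist_zero_right, Real.norm_of_nonneg (by positivity)]; linarith)
  have hne : θ ≠ θ + (ε / 2) • w := by
    simp [hw, hε.ne']
  refine hF.identifiable θ hθ _ ht hne ?_
  rw [← domain_eq hF] at hθ ht
  have hin : ∀ᵐ x ∂F.lam, inner ℝ (θ + (ε / 2) • w) (F.s x) =
      inner ℝ θ (F.s x) + ε / 2 * inner ℝ w m := by
    filter_upwards [h] with x hx
    rw [inner_sub_right, sub_eq_zero] at hx
    rw [inner_add_left, real_inner_smul_left, hx]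
  have hp : partition F.lam F.s (θ + (ε / 2) • w) =
      partition F.lam F.s θ * Real.exp (ε / 2 * inner ℝ w m) := by
    rw [partition, partition, ← integral_mul_const]
    refine integral_congr_ae ?_
    filter_upwards [hin] with x hx
    rw [hx, Real.exp_add]
  have hc : cumulant F.lam F.s (θ + (ε / 2) • w) =
      cumulant F.lam F.s θ + ε / 2 * inner ℝ w m := by
    rw [cumulant, hp, Real.log_mul (partition_pos F.lam_ne_zero hθ).ne' (Real.exp_pos _).ne',
      Real.log_exp, cumulant]
  refine withDensity_congr_ae ?_
  filter_upwards [hin] with x hx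
  rw [density_eq hθ, density_eq ht, hx, hc, add_sub_add_right_eq_sub]

/-- The supremum is attained at `θ₁`: the deficit at any other `θ` is the Bregman divergence. -/
lemma legendre_mean_eq (hF : F.Regularity) (hθ₁ : θ₁ ∈ domain F.lam F.s) :
    F.legendre (mean F.lam F.s θ₁) =
      ((inner ℝ θ₁ (mean F.lam F.s θ₁) - cumulant F.lam F.s θ₁ : ℝ) : EReal) := by
  have ho : IsOpen (domain F.lam F.s) := domain_eq hF ▸ hF.regular
  rw [legendre, ← domain_eq hF]
  refine le_antisymm (iSup₂_le fun θ hθ => ?_) ?_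
  · rw [kappa_eq hθ, ← EReal.coe_sub, EReal.coe_le_coe_iff]
    have := bregman_nonneg F.measurable_s F.lam_ne_zero ho hθ₁ hθ
    rw [bregman, inner_sub_right, real_inner_comm θ, real_inner_comm θ₁] at this
    linarith
  · rw [EReal.coe_sub, ← kappa_eq hθ₁]
    exact le_iSup₂ (f := fun θ (_ : θ ∈ domain F.lam F.s) =>
      ((inner ℝ θ (mean F.lam F.s θ₁) : ℝ) : EReal) - F.kappa θ) θ₁ hθ₁

lemma setLIntegral_exp_eq (lam : Measure F.X) (s : F.X → EuclideanSpace ℝ (Fin k)) {N : ℝ}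
    (hN : 0 < N) (θ₁ : EuclideanSpace ℝ (Fin k)) :
    ∫⁻ θ in domain lam s,
      ENNReal.ofReal (Real.exp (inner ℝ (N • mean lam s θ₁) θ - N * cumulant lam s θ)) =
    ENNReal.ofReal (N ^ (-(k : ℝ) / 2)) *
      ENNReal.ofReal (Real.exp (N * (inner ℝ θ₁ (mean lam s θ₁) - cumulant lam s θ₁))) *
      laplaceIntegral lam s N θ₁ := by
  have h1 : ENNReal.ofReal (N ^ (-(k : ℝ) / 2)) * ENNReal.ofReal (N ^ ((k : ℝ) / 2)) = 1 := by
    rw [← ENNReal.ofReal_mul (by positivity), ← Real.rpow_add hN]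
    ring_nf
    simp
  rw [laplaceIntegral, mul_right_comm, ← mul_assoc (ENNReal.ofReal _) (ENNReal.ofReal _), h1,
    one_mul, mul_comm, ← lintegral_const_mul' _ _ ENNReal.ofReal_ne_top]
  congr 1 with θ
  rw [← ENNReal.ofReal_mul (Real.exp_pos _).le, ← Real.exp_add, bregman, inner_sub_right,
    real_inner_smul_left, real_inner_comm θ₁]
  ring_nf

/-- The prior normaliser is itself a Laplace integral, with `N = ν` and mean `ξ/ν`, so the compact
bound for a singleton makes it positive and finite. -/
lemma exists_psi_eq (hF : F.Regularity) {ξ : EuclideanSpace ℝ (Fin k)} {ν : ℝ}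
    (h : (ξ, ν) ∈ F.hyperparams) : ∃ p : ℝ, F.psi ξ ν = (p : EReal) := by
  obtain ⟨hν, hm⟩ := h
  have ho : IsOpen (domain F.lam F.s) := domain_eq hF ▸ hF.regular
  rw [momentSpace_eq hF] at hm
  obtain ⟨θ₁, hθ₁, hm⟩ := hm
  dsimp only at hν hm
  have hξ : ξ = ν • mean F.lam F.s θ₁ := by rw [hm, smul_smul, mul_inv_cancel₀ hν.ne', one_smul]
  obtain ⟨C₁, C₂, hC₁, -, hb⟩ := exists_laplaceIntegral_bounds_of_isCompact F.measurable_s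
    F.lam_ne_zero ho (not_ae_inner_sub_eq_zero hF) hν (isCompact_singleton (x := mean F.lam F.s θ₁))
    (Set.singleton_subset_iff.2 ⟨θ₁, hθ₁, rfl⟩)
  obtain ⟨h1, h2⟩ := hb θ₁ hθ₁ rfl ν le_rfl
  have heq : ∫⁻ θ in F.Θ, EReal.exp ((inner ℝ ξ θ : ℝ) - (ν : EReal) * F.kappa θ) =
      ENNReal.ofReal (ν ^ (-(k : ℝ) / 2)) *
      ENNReal.ofReal (Real.exp (ν * (inner ℝ θ₁ (mean F.lam F.s θ₁) - cumulant F.lam F.s θ₁))) *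
      laplaceIntegral F.lam F.s ν θ₁ := by
    rw [← setLIntegral_exp_eq _ _ hν, ← domain_eq hF]
    refine setLIntegral_congr_fun ho.measurableSet fun θ hθ => ?_
    rw [kappa_eq hθ, ← hξ, ← EReal.coe_mul, ← EReal.coe_sub, EReal.exp_coe]
  rw [psi, heq]
  refine ⟨_, ENNReal.log_pos_real ?_ ?_⟩
  · refine mul_ne_zero (mul_ne_zero ?_ ?_) ?_
    · exact (ENNReal.ofReal_pos.2 (Real.rpow_pos_of_pos hν _)).ne'
    · exact (ENNReal.ofReal_pos.2 (Real.exp_pos _)).ne'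
    · exact ((ENNReal.ofReal_pos.2 hC₁).trans_le h1).ne'
  · exact ENNReal.mul_ne_top (ENNReal.mul_ne_top ENNReal.ofReal_ne_top ENNReal.ofReal_ne_top)
        (h2.trans_lt ENNReal.ofReal_lt_top).ne

lemma marginal_div_approxMarginal_eq (hF : F.Regularity) {ξ : EuclideanSpace ℝ (Fin k)} {ν : ℝ}
    (hν : 0 < ν) {p : ℝ} (hp : F.psi ξ ν = (p : EReal)) (hθ₁ : θ₁ ∈ domain F.lam F.s) {n : ℕ}
    (x : Fin n → F.X) (hx : F.posteriorMean ξ ν x = mean F.lam F.s θ₁) :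
    F.marginal ξ ν x / F.approxMarginal ξ ν x =
      ENNReal.ofReal (Real.exp (-p)) * laplaceIntegral F.lam F.s (ν + n) θ₁ := by
  have ho : IsOpen (domain F.lam F.s) := domain_eq hF ▸ hF.regular
  have hN : 0 < ν + n := by positivity
  have hsum : ξ + ∑ j, F.s (x j) = (ν + n) • mean F.lam F.s θ₁ := by
    rw [← hx, posteriorMean, smul_smul, mul_inv_cancel₀ hN.ne', one_smul]
  have hmarg : F.marginal ξ ν x = ENNReal.ofReal (Real.exp (-p)) *
      ∫⁻ θ in domain F.lam F.s, ENNReal.ofReal (Real.exp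
        (inner ℝ ((ν + n) • mean F.lam F.s θ₁) θ - (ν + n) * cumulant F.lam F.s θ)) := by
    rw [marginal, ← domain_eq hF, ← lintegral_const_mul' _ _ ENNReal.ofReal_ne_top]
    refine setLIntegral_congr_fun ho.measurableSet fun θ hθ => ?_
    rw [prior, ← domain_eq hF, Set.indicator_of_mem hθ, kappa_eq hθ, hp, ← EReal.coe_mul,
      ← EReal.coe_sub, ← EReal.coe_sub, EReal.exp_coe]
    simp only [density_eq hθ]
    rw [← ENNReal.ofReal_prod_of_nonneg fun _ _ => (Real.exp_pos _).le, ← Real.exp_sum,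
      ← ENNReal.ofReal_mul (Real.exp_pos _).le, ← ENNReal.ofReal_mul (Real.exp_pos _).le,
      ← Real.exp_add, ← Real.exp_add, ← hsum, inner_add_left, sum_inner, Finset.sum_sub_distrib]
    simp only [real_inner_comm θ, Finset.sum_const, Finset.card_univ, Fintype.card_fin,
      nsmul_eq_mul]
    ring_nf
  rw [hmarg, setLIntegral_exp_eq _ _ hN, approxMarginal, hx, legendre_mean_eq hF hθ₁,
    ← EReal.coe_mul, EReal.exp_coe, mul_left_comm]
  rw [mul_comm, mul_div_assoc, ENNReal.div_self, mul_one]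
  · exact mul_ne_zero (ENNReal.ofReal_pos.2 (Real.rpow_pos_of_pos hN _)).ne'
      (ENNReal.ofReal_pos.2 (Real.exp_pos _)).ne'
  · exact ENNReal.mul_ne_top ENNReal.ofReal_ne_top ENNReal.ofReal_ne_top

end Translation
end ExpFamily
end

theorem mainTheorem8 {d k : ℕ} (F : ExpFamily d k) (ξ : EuclideanSpace ℝ (Fin k)) (ν : ℝ)
    (hF : F.WellBehaved ξ ν) (U : Set (EuclideanSpace ℝ (Fin k)))
    (hU : IsCompact U) (hUM : U ⊆ F.momentSpace) :
    ∃ C₁ C₂ : ℝ, 0 < C₁ ∧ C₁ ≤ C₂ ∧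
      ∀ n : ℕ, 1 ≤ n → ∀ x : Fin n → F.X, F.posteriorMean ξ ν x ∈ U →
        ENNReal.ofReal C₁ ≤ F.marginal ξ ν x / F.approxMarginal ξ ν x ∧
          F.marginal ξ ν x / F.approxMarginal ξ ν x ≤ ENNReal.ofReal C₂ := by
  have hR := hF.regularity
  have hν : 0 < ν := hF.mem_hyperparams.1
  obtain ⟨p, hp⟩ := ExpFamily.exists_psi_eq hR hF.mem_hyperparams
  rw [ExpFamily.momentSpace_eq hR] at hUM
  obtain ⟨C₁, C₂, hC₁, hC, hb⟩ := ExpFamily.exists_laplaceIntegral_bounds_of_isCompact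
    F.measurable_s F.lam_ne_zero (ExpFamily.domain_eq hR ▸ hR.regular)
    (ExpFamily.not_ae_inner_sub_eq_zero hR) hν hU hUM
  have hE := Real.exp_pos (-p)
  refine ⟨Real.exp (-p) * C₁, Real.exp (-p) * C₂, by positivity, by gcongr, fun n _ x hx => ?_⟩
  obtain ⟨θ₁, hθ₁, hm⟩ := hUM hx
  rw [ExpFamily.marginal_div_approxMarginal_eq hR hν hp hθ₁ x hm.symm,
    ENNReal.ofReal_mul hE.le, ENNReal.ofReal_mul hE.le]
  obtain ⟨h1, h2⟩ := hb θ₁ hθ₁ (hm ▸ hx) (ν + n) (by linarith [Nat.cast_nonneg (α := ℝ) n])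
  exact ⟨mul_le_mul' le_rfl h1, mul_le_mul' le_rfl h2⟩
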